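/- Let $U\subset\mathbb R^{d}$ be a measurable set with $\operatorname{Leb}(U)>0$ and let $\lambda>0$. For a measurable $h:U\to\mathbb R$ and a probability measure $\gamma$ on $U$ with Lebesgue density $\dot\gamma$ put $$L(\gamma,h)=\int_U\bigl[h(a)-\lambda\log\dot\gamma(a)\bigr]\dot\gamma(a)\,da ,$$ the integrand being $0$ where $\dot\gamma=0$. (1) If $h$ is measurable and $\int_U e^{h(a)/\lambda}\,da<\infty$, then $L(\gamma,h)$ is well defined in $[-\infty,\infty)$ for every probability measure $\gamma$ on $U$ with a density, and the measure $\gamma^{*}$ with density $$\dot\gamma^{*}(a)=\frac{e^{h(a)/\lambda}}{\int_U e^{h(a')/\lambda}\,da'}$$ is the unique maximizer of $L(\cdot,h)$ over the probability measures on $U$ that have a density. The optimal value is $$\sup_{\gamma}L(\gamma,h)=L(\gamma^{*},h)=\lambda\log\int_U e^{h(a)/\lambda}\,da .$$ (2) Let $b:[0,T]\times\mathbb R^m\times U\to\mathbb R^m$ be a drift, $R:[0,T]\times\mathbb R^m\times U\to\mathbb R$ a reward, and $$\tilde H(t,y,a,p)=p\cdot b(t,y,a)+R(t,y,a),\qquad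 H(t,y,\gamma,p)=\int_U\bigl[\tilde H(t,y,a,p)-\lambda\log\dot\gamma(a)\bigr]\dot\gamma(a)\,da .$$ Let $v:[0,T]\times\mathbb R^m\to\mathbb R$ be any function (for instance the solution of the rough Hamilton--Jacobi--Bellman equation $\partial_t v+\sup_{\gamma}H(t,y,\gamma,\nabla v)+\nabla v\cdot\sigma(t,y)\,\dot\zeta_t=0$, $v(T,\cdot)=G$), and let $(t,y)\in[0,T]\times\mathbb R^m$ be such that $v(t,\cdot)$ is differentiable at $y$ and $b(t,y,\cdot)$, $R(t,y,\cdot)$ are measurable. If $\int_U e^{\tilde H(t,y,a,\nabla v(t,y))/\lambda}\,da<\infty$ (which always holds when $\operatorname{Leb}(U)<\infty$ and $b(t,y,\cdot)$, $R(t,y,\cdot)$ are bounded), then the feedback policy with density $$\dot\gamma^{*}_t(a\mid y)=\frac{\exp\bigl(\tilde H(t,y,a,\nabla v(t,y))/\lambda\bigr)}{\int_U\exp\bigl(\tilde H(t,y,a',\nabla v(t,y))/\lambda\bigr)\,da'}$$ is the unique maximizer of $\gamma\mapsto H(t,y,\gamma,\nabla v(t,y))$ over the probability measures on $U$ that have a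 density, and $$\sup_{\gamma}H(t,y,\gamma,\nabla v(t,y))=H(t,y,\gamma^{*}_t,\nabla v(t,y))=\lambda\log\int_U\exp\bigl(\tilde H(t,y,a,\nabla v(t,y))/\lambda\bigr)\,da .$$ -/

import Mathlib

open MeasureTheory

noncomputable section

namespace GibbsPolicy

/-- Lebesgue measure on the action space `U ⊆ ℝᵈ`. -/
def lebesgueOn {d : ℕ} (U : Set (EuclideanSpace ℝ (Fin d))) : Measure U :=
  volume.comap (Subtype.val : U → EuclideanSpace ℝ (Fin d))

section Objective

variable {A : Type*} [MeasurableSpace A]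

/-- The integral `∫ f dμ` as an extended real, `∫ f⁺ dμ - ∫ f⁻ dμ`. It is meaningful as soon as one
of the two parts has a finite integral, and is then allowed to be `±∞`. -/
def extIntegral (μ : Measure A) (f : A → ℝ) : EReal :=
  ((∫⁻ a, ENNReal.ofReal (f a) ∂μ : ENNReal) : EReal) -
    ((∫⁻ a, ENNReal.ofReal (-f a) ∂μ : ENNReal) : EReal)

/-- The probability measures that admit a density with respect to `μ`. -/
def densityPolicies (μ : Measure A) : Set (Measure A) :=
  {γ | IsProbabilityMeasure γ ∧ γ ≪ μ}

/-- The (real-valued) density `γ̇ = dγ/dμ`. -/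
def density (μ γ : Measure A) (a : A) : ℝ := (γ.rnDeriv μ a).toReal

/-- The integrand `[h(a) - λ log γ̇(a)] γ̇(a)`; it is `0` where `γ̇(a) = 0`. -/
def objectiveIntegrand (μ : Measure A) (lam : ℝ) (h : A → ℝ) (γ : Measure A) (a : A) : ℝ :=
  (h a - lam * Real.log (density μ γ a)) * density μ γ a

/-- `L(γ, h) = ∫ [h(a) - λ log γ̇(a)] γ̇(a) μ(da)`. -/
def objective (μ : Measure A) (lam : ℝ) (h : A → ℝ) (γ : Measure A) : EReal :=
  extIntegral μ (objectiveIntegrand μ lam h γ)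

/-- The Gibbs density `exp(h(a)/λ) / ∫ exp(h/λ) dμ`. -/
def gibbsDensity (μ : Measure A) (lam : ℝ) (h : A → ℝ) (a : A) : ℝ :=
  Real.exp (h a / lam) / ∫ a', Real.exp (h a' / lam) ∂μ

/-- The measure whose density with respect to `μ` is the Gibbs density. -/
def gibbsMeasure (μ : Measure A) (lam : ℝ) (h : A → ℝ) : Measure A :=
  μ.withDensity fun a => ENNReal.ofReal (gibbsDensity μ lam h a)

/-- `γ` lies in `D`, attains the supremum of `Φ` over `D`, and is the only element of `D` that
does so. -/
def IsUniqueMaximizer (D : Set (Measure A)) (Φ : Measure A → EReal) (γ : Measure A) : Prop :=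
  γ ∈ D ∧ (⨆ η ∈ D, Φ η) = Φ γ ∧ ∀ γ' ∈ D, (⨆ η ∈ D, Φ η) = Φ γ' → γ' = γ

end Objective

section Hamiltonian

variable {m : ℕ} {A : Type*} [MeasurableSpace A]

/-- `H̃(t, y, a, p) = p · b(t, y, a) + R(t, y, a)`. -/
def preHamiltonian {A : Type*}
    (b : ℝ → EuclideanSpace ℝ (Fin m) → A → EuclideanSpace ℝ (Fin m))
    (R : ℝ → EuclideanSpace ℝ (Fin m) → A → ℝ)
    (t : ℝ) (y : EuclideanSpace ℝ (Fin m)) (a : A) (p : EuclideanSpace ℝ (Fin m)) : ℝ :=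
  inner ℝ p (b t y a) + R t y a

/-- The entropy-regularized Hamiltonian
`H(t, y, γ, p) = ∫ [H̃(t, y, a, p) - λ log γ̇(a)] γ̇(a) μ(da)`. -/
def hamiltonian (μ : Measure A) (lam : ℝ)
    (b : ℝ → EuclideanSpace ℝ (Fin m) → A → EuclideanSpace ℝ (Fin m))
    (R : ℝ → EuclideanSpace ℝ (Fin m) → A → ℝ)
    (t : ℝ) (y : EuclideanSpace ℝ (Fin m)) (γ : Measure A) (p : EuclideanSpace ℝ (Fin m)) :
    EReal :=
  objective μ lam (fun a => preHamiltonian b R t y a p) γ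

/-- The feedback policy `γ*(da | t, y)` with density
`exp(H̃(t, y, a, ∇v(t, y))/λ) / ∫ exp(H̃(t, y, ·, ∇v(t, y))/λ) dμ`. -/
def feedbackPolicy (μ : Measure A) (lam : ℝ)
    (b : ℝ → EuclideanSpace ℝ (Fin m) → A → EuclideanSpace ℝ (Fin m))
    (R : ℝ → EuclideanSpace ℝ (Fin m) → A → ℝ)
    (v : ℝ → EuclideanSpace ℝ (Fin m) → ℝ)
    (t : ℝ) (y : EuclideanSpace ℝ (Fin m)) : Measure A :=
  gibbsMeasure μ lam fun a => preHamiltonian b R t y a (gradient (v t) y)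

end Hamiltonian

end GibbsPolicy

end

/-! Write Z for the integral of exp(h/λ), γ̇* = exp(h/λ)/Z and γ̇ for a competing density. Since h =
λ log Z + λ log γ̇*, the integrand of L(γ, h) is λ log Z · γ̇ + λ γ̇ (log γ̇* - log γ̇), so formally
L(γ, h) is λ log Z minus λ times the relative entropy of γ with respect to γ*. The sign of the
entropy is used pointwise: `mul_log_sub_log_le` puts the integrand below `gibbsMajorant`, which is
integrable with integral λ log Z for every admissible γ (`integral_gibbsMajorant`). This one
domination bounds the positive part and the objective, and its equality case
`eq_of_mul_log_sub_log_eq` gives uniqueness. Energy and entropy are never integrated separately, so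
neither has to be finite. The Hamiltonian statement is the case h = H̃(t, y, ·, ∇v(t, y)). -/

namespace GibbsPolicy

section General

variable {A : Type*} [MeasurableSpace A] {μ : Measure A} {lam : ℝ} {h : A → ℝ}

/-! ### Extended integrals under an integrable majorant -/

/-- For an integrable function the extended integral is the Bochner integral. -/
theorem extIntegral_eq_integral {f : A → ℝ} (hf : Integrable f μ) :
    extIntegral μ f = ((∫ a, f a ∂μ : ℝ) : EReal) := by
  have h1 : ∫⁻ a, ENNReal.ofReal (f a) ∂μ ≠ ⊤ := hf.lintegral_lt_top.ne
  have h2 : ∫⁻ a, ENNReal.ofReal (-f a) ∂μ ≠ ⊤ := hf.neg.lintegral_lt_top.ne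
  rw [extIntegral, integral_eq_lintegral_pos_part_sub_lintegral_neg_part hf, EReal.coe_sub,
    ← EReal.toReal_coe_ennreal, ← EReal.toReal_coe_ennreal, EReal.coe_toReal (by simpa using h1)
      (EReal.coe_ennreal_ne_bot _), EReal.coe_toReal (by simpa using h2)
      (EReal.coe_ennreal_ne_bot _)]

/-- A function dominated by an integrable one has an integrable positive part. -/
theorem lintegral_ofReal_lt_top_of_ae_le {f g : A → ℝ} (hg : Integrable g μ)
    (hfg : f ≤ᵐ[μ] g) : ∫⁻ a, ENNReal.ofReal (f a) ∂μ < ⊤ := by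
  refine (lintegral_mono_ae ?_).trans_lt hg.lintegral_lt_top
  filter_upwards [hfg] with a ha using ENNReal.ofReal_le_ofReal ha

/-- If the negative part of a function dominated by an integrable one has infinite integral, the
extended integral is `-∞`; otherwise the function is integrable. -/
theorem integrable_or_extIntegral_eq_bot {f g : A → ℝ} (hf : AEStronglyMeasurable f μ)
    (hg : Integrable g μ) (hfg : f ≤ᵐ[μ] g) : Integrable f μ ∨ extIntegral μ f = ⊥ := by
  have hpos := lintegral_ofReal_lt_top_of_ae_le hg hfg
  by_cases hneg : ∫⁻ a, ENNReal.ofReal (-f a) ∂μ = ⊤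
  · right
    -- In `EReal`, subtracting `⊤` gives `⊥` from any value, so `hpos` is needed only in the other
    -- branch.
    simp [extIntegral, hneg, EReal.sub_top]
  · left
    refine ⟨hf, ?_⟩
    rw [hasFiniteIntegral_iff_norm]
    have hsum : ∀ a, ENNReal.ofReal ‖f a‖ ≤ ENNReal.ofReal (f a) + ENNReal.ofReal (-f a) := by
      intro a
      rcases le_total 0 (f a) with ha | ha
      · rw [Real.norm_of_nonneg ha]
        exact le_self_add
      · rw [Real.norm_of_nonpos ha]
        exact le_add_self
    refine (lintegral_mono hsum).trans_lt ?_
    rw [lintegral_add_left' hf.aemeasurable.ennreal_ofReal]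
    exact ENNReal.add_lt_top.2 ⟨hpos, lt_top_iff_ne_top.2 hneg⟩

theorem extIntegral_le_integral_of_ae_le {f g : A → ℝ} (hf : AEStronglyMeasurable f μ)
    (hg : Integrable g μ) (hfg : f ≤ᵐ[μ] g) :
    extIntegral μ f ≤ ((∫ a, g a ∂μ : ℝ) : EReal) := by
  rcases integrable_or_extIntegral_eq_bot hf hg hfg with hi | hb
  · rw [extIntegral_eq_integral hi]
    exact_mod_cast integral_mono_ae hi hg hfg
  · simp [hb]

/-- A finite value excludes `⊥`, so `f` is integrable and the equality case of monotonicity applies.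
-/
theorem ae_eq_of_extIntegral_eq_integral {f g : A → ℝ} (hf : AEStronglyMeasurable f μ)
    (hg : Integrable g μ) (hfg : f ≤ᵐ[μ] g)
    (heq : extIntegral μ f = ((∫ a, g a ∂μ : ℝ) : EReal)) : f =ᵐ[μ] g := by
  rcases integrable_or_extIntegral_eq_bot hf hg hfg with hi | hb
  · rw [extIntegral_eq_integral hi] at heq
    exact (integral_eq_iff_of_ae_le hi hg hfg).1 (by exact_mod_cast heq)
  · rw [hb] at heq
    exact absurd heq (EReal.bot_ne_coe _)

/-! ### The pointwise inequality and its equality case -/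

/-- The pointwise Gibbs inequality. -/
theorem mul_log_sub_log_le {p q : ℝ} (hp : 0 < p) (hq : 0 ≤ q) :
    q * (Real.log p - Real.log q) ≤ p - q := by
  rcases hq.eq_or_lt with rfl | hq
  · simpa using hp.le
  · have := Real.log_le_sub_one_of_pos (div_pos hp hq)
    rw [Real.log_div hp.ne' hq.ne'] at this
    calc q * (Real.log p - Real.log q) ≤ q * (p / q - 1) := by gcongr
      _ = p - q := by field_simp

/-- Strictness of log x < x - 1 for x = p/q ≠ 1; at q = 0 the equation would force p = 0. -/
theorem eq_of_mul_log_sub_log_eq {p q : ℝ} (hp : 0 < p) (hq : 0 ≤ q)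
    (heq : q * (Real.log p - Real.log q) = p - q) : q = p := by
  rcases hq.eq_or_lt with rfl | hq
  · simp at heq
    linarith
  · by_contra hne
    have hne' : p / q ≠ 1 := fun hc => hne (by rw [div_eq_one_iff_eq hq.ne'] at hc; exact hc.symm)
    have := Real.log_lt_sub_one_of_pos (div_pos hp hq) hne'
    rw [Real.log_div hp.ne' hq.ne'] at this
    have h2 : q * (Real.log p - Real.log q) < q * (p / q - 1) := by gcongr
    have h3 : q * (p / q - 1) = p - q := by field_simp
    linarith

/-! ### Densities and the Gibbs measure -/

theorem measurable_density (γ : Measure A) : Measurable (density μ γ) :=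
  (Measure.measurable_rnDeriv γ μ).ennreal_toReal

theorem density_nonneg (γ : Measure A) (a : A) : 0 ≤ density μ γ a := ENNReal.toReal_nonneg

theorem integrable_density (γ : Measure A) [IsFiniteMeasure γ] : Integrable (density μ γ) μ :=
  Measure.integrable_toReal_rnDeriv

theorem integral_density [SigmaFinite μ] {γ : Measure A} (hγ : γ ∈ densityPolicies μ) :
    ∫ a, density μ γ a ∂μ = 1 := by
  have := hγ.1
  simp [density, Measure.integral_toReal_rnDeriv hγ.2]

/-- Two elements of `densityPolicies μ` with the same density coincide. -/
theorem eq_of_density_ae_eq [SigmaFinite μ] {γ γ' : Measure A} (hγ : γ ∈ densityPolicies μ)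
    (hγ' : γ' ∈ densityPolicies μ) (heq : density μ γ =ᵐ[μ] density μ γ') : γ = γ' := by
  have := hγ.1
  have := hγ'.1
  rw [← Measure.withDensity_rnDeriv_eq γ μ hγ.2, ← Measure.withDensity_rnDeriv_eq γ' μ hγ'.2]
  refine withDensity_congr_ae ?_
  -- `toReal` is injective only away from `⊤`, hence the a.e. finiteness of both derivatives.
  filter_upwards [heq, Measure.rnDeriv_ne_top γ μ, Measure.rnDeriv_ne_top γ' μ] with a ha h1 h2
  exact (ENNReal.toReal_eq_toReal_iff' h1 h2).1 ha

theorem measurable_objectiveIntegrand (hh : Measurable h) (γ : Measure A) :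
    Measurable (objectiveIntegrand μ lam h γ) :=
  (hh.sub ((Real.measurable_log.comp (measurable_density γ)).const_mul lam)).mul
    (measurable_density γ)

theorem gibbsDensity_pos [NeZero μ] (hint : Integrable (fun a => Real.exp (h a / lam)) μ) (a : A) :
    0 < gibbsDensity μ lam h a :=
  div_pos (Real.exp_pos _) (integral_exp_pos hint)

theorem integrable_gibbsDensity (hint : Integrable (fun a => Real.exp (h a / lam)) μ) :
    Integrable (gibbsDensity μ lam h) μ :=
  hint.div_const _

theorem integral_gibbsDensity [NeZero μ] (hint : Integrable (fun a => Real.exp (h a / lam)) μ) :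
    ∫ a, gibbsDensity μ lam h a ∂μ = 1 := by
  simp only [gibbsDensity]
  rw [integral_div, div_self (integral_exp_pos hint).ne']

theorem gibbsMeasure_mem_densityPolicies [NeZero μ]
    (hint : Integrable (fun a => Real.exp (h a / lam)) μ) :
    gibbsMeasure μ lam h ∈ densityPolicies μ := by
  refine ⟨⟨?_⟩, withDensity_absolutelyContinuous _ _⟩
  rw [gibbsMeasure, withDensity_apply _ MeasurableSet.univ, Measure.restrict_univ,
    ← ofReal_integral_eq_lintegral_ofReal (integrable_gibbsDensity hint)
      (ae_of_all _ fun a => (gibbsDensity_pos hint a).le), integral_gibbsDensity hint,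
    ENNReal.ofReal_one]

theorem density_gibbsMeasure [SigmaFinite μ] [NeZero μ]
    (hint : Integrable (fun a => Real.exp (h a / lam)) μ) :
    density μ (gibbsMeasure μ lam h) =ᵐ[μ] gibbsDensity μ lam h := by
  have hm : AEMeasurable (fun a => ENNReal.ofReal (gibbsDensity μ lam h a)) μ :=
    (integrable_gibbsDensity hint).aemeasurable.ennreal_ofReal
  filter_upwards [Measure.rnDeriv_withDensity₀ μ hm] with a ha
  rw [density, gibbsMeasure, ha, ENNReal.toReal_ofReal (gibbsDensity_pos hint a).le]

/-! ### Domination by the majorant and optimality -/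

/-- The objective integrand, rewritten through the Gibbs density. -/
theorem objectiveIntegrand_eq [NeZero μ] (hlam : lam ≠ 0)
    (hint : Integrable (fun a => Real.exp (h a / lam)) μ) (γ : Measure A) (a : A) :
    objectiveIntegrand μ lam h γ a =
      lam * Real.log (∫ a', Real.exp (h a' / lam) ∂μ) * density μ γ a +
        lam * (density μ γ a *
          (Real.log (gibbsDensity μ lam h a) - Real.log (density μ γ a))) := by
  rw [objectiveIntegrand, gibbsDensity,
    Real.log_div (Real.exp_pos _).ne' (integral_exp_pos hint).ne', Real.log_exp]
  field_simp
  ring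

/-- The function `λ log Z γ̇ + λ (γ̇* - γ̇)`, which dominates the objective integrand and has
integral `λ log Z`. -/
noncomputable def gibbsMajorant (μ : Measure A) (lam : ℝ) (h : A → ℝ) (γ : Measure A) (a : A) : ℝ :=
  lam * Real.log (∫ a', Real.exp (h a' / lam) ∂μ) * density μ γ a +
    lam * (gibbsDensity μ lam h a - density μ γ a)

theorem objectiveIntegrand_le_gibbsMajorant [NeZero μ] (hlam : 0 < lam)
    (hint : Integrable (fun a => Real.exp (h a / lam)) μ) (γ : Measure A) (a : A) :
    objectiveIntegrand μ lam h γ a ≤ gibbsMajorant μ lam h γ a := by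
  rw [objectiveIntegrand_eq hlam.ne' hint, gibbsMajorant]
  gcongr
  exact mul_log_sub_log_le (gibbsDensity_pos hint a) (density_nonneg γ a)

theorem density_eq_of_objectiveIntegrand_eq [NeZero μ] (hlam : 0 < lam)
    (hint : Integrable (fun a => Real.exp (h a / lam)) μ) {γ : Measure A} {a : A}
    (heq : objectiveIntegrand μ lam h γ a = gibbsMajorant μ lam h γ a) :
    density μ γ a = gibbsDensity μ lam h a := by
  rw [objectiveIntegrand_eq hlam.ne' hint, gibbsMajorant] at heq
  exact eq_of_mul_log_sub_log_eq (gibbsDensity_pos hint a) (density_nonneg γ a)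
    (mul_left_cancel₀ hlam.ne' (add_left_cancel heq))

theorem integrable_gibbsMajorant (hint : Integrable (fun a => Real.exp (h a / lam)) μ)
    (γ : Measure A) [IsFiniteMeasure γ] : Integrable (gibbsMajorant μ lam h γ) μ :=
  ((integrable_density γ).const_mul _).add
    (((integrable_gibbsDensity hint).sub (integrable_density γ)).const_mul _)

/-- Both densities have mass one, so the correction λ (γ̇* - γ̇) integrates to zero. -/
theorem integral_gibbsMajorant [SigmaFinite μ] [NeZero μ]
    (hint : Integrable (fun a => Real.exp (h a / lam)) μ) {γ : Measure A}
    (hγ : γ ∈ densityPolicies μ) :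
    ∫ a, gibbsMajorant μ lam h γ a ∂μ =
      lam * Real.log (∫ a', Real.exp (h a' / lam) ∂μ) := by
  have := hγ.1
  have hd : Integrable (density μ γ) μ := integrable_density γ
  have hg := integrable_gibbsDensity hint
  simp only [gibbsMajorant]
  have hi : Integrable (fun a => lam * (gibbsDensity μ lam h a - density μ γ a)) μ :=
    (hg.sub hd).const_mul _
  rw [integral_add (hd.const_mul _) hi, integral_const_mul,
    integral_const_mul, integral_sub hg hd, integral_density hγ, integral_gibbsDensity hint]
  ring

theorem lintegral_objectiveIntegrand_lt_top [NeZero μ] (hlam : 0 < lam)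
    (hint : Integrable (fun a => Real.exp (h a / lam)) μ) {γ : Measure A}
    (hγ : γ ∈ densityPolicies μ) :
    ∫⁻ a, ENNReal.ofReal (objectiveIntegrand μ lam h γ a) ∂μ < ⊤ := by
  have := hγ.1
  exact lintegral_ofReal_lt_top_of_ae_le (integrable_gibbsMajorant hint γ)
    (ae_of_all _ (objectiveIntegrand_le_gibbsMajorant hlam hint γ))

theorem objective_le [SigmaFinite μ] [NeZero μ] (hlam : 0 < lam) (hh : Measurable h)
    (hint : Integrable (fun a => Real.exp (h a / lam)) μ) {γ : Measure A}
    (hγ : γ ∈ densityPolicies μ) :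
    objective μ lam h γ ≤ ((lam * Real.log (∫ a, Real.exp (h a / lam) ∂μ) : ℝ) : EReal) := by
  have := hγ.1
  rw [← integral_gibbsMajorant hint hγ]
  exact extIntegral_le_integral_of_ae_le
    (measurable_objectiveIntegrand hh γ).aestronglyMeasurable (integrable_gibbsMajorant hint γ)
    (ae_of_all _ (objectiveIntegrand_le_gibbsMajorant hlam hint γ))

/-- At γ* the logarithmic term and the linear correction both vanish a.e., so the integrand inherits
integrability from the majorant. -/
theorem objective_gibbsMeasure [SigmaFinite μ] [NeZero μ] (hlam : 0 < lam)
    (hint : Integrable (fun a => Real.exp (h a / lam)) μ) :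
    objective μ lam h (gibbsMeasure μ lam h) =
      ((lam * Real.log (∫ a, Real.exp (h a / lam) ∂μ) : ℝ) : EReal) := by
  have hmem := gibbsMeasure_mem_densityPolicies hint
  have := hmem.1
  have hae : gibbsMajorant μ lam h (gibbsMeasure μ lam h) =ᵐ[μ]
      objectiveIntegrand μ lam h (gibbsMeasure μ lam h) := by
    filter_upwards [density_gibbsMeasure hint] with a ha
    rw [objectiveIntegrand_eq hlam.ne' hint, gibbsMajorant, ha]
    ring
  rw [objective, extIntegral_eq_integral ((integrable_gibbsMajorant hint _).congr hae),
    ← integral_congr_ae hae, integral_gibbsMajorant hint hmem]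

theorem eq_gibbsMeasure_of_objective_eq [SigmaFinite μ] [NeZero μ] (hlam : 0 < lam)
    (hh : Measurable h) (hint : Integrable (fun a => Real.exp (h a / lam)) μ) {γ : Measure A}
    (hγ : γ ∈ densityPolicies μ)
    (heq : objective μ lam h γ =
      ((lam * Real.log (∫ a, Real.exp (h a / lam) ∂μ) : ℝ) : EReal)) :
    γ = gibbsMeasure μ lam h := by
  have := hγ.1
  rw [← integral_gibbsMajorant hint hγ] at heq
  have hae := ae_eq_of_extIntegral_eq_integral
    (measurable_objectiveIntegrand hh γ).aestronglyMeasurable (integrable_gibbsMajorant hint γ)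
    (ae_of_all _ (objectiveIntegrand_le_gibbsMajorant hlam hint γ)) heq
  refine eq_of_density_ae_eq hγ (gibbsMeasure_mem_densityPolicies hint) ?_
  filter_upwards [hae, density_gibbsMeasure hint] with a ha hg
  rw [hg, density_eq_of_objectiveIntegrand_eq hlam hint ha]

theorem iSup_objective [SigmaFinite μ] [NeZero μ] (hlam : 0 < lam) (hh : Measurable h)
    (hint : Integrable (fun a => Real.exp (h a / lam)) μ) :
    (⨆ γ ∈ densityPolicies μ, objective μ lam h γ) =
      ((lam * Real.log (∫ a, Real.exp (h a / lam) ∂μ) : ℝ) : EReal) := by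
  refine le_antisymm (iSup₂_le fun γ hγ => objective_le hlam hh hint hγ) ?_
  rw [← objective_gibbsMeasure hlam hint]
  exact le_iSup₂ (f := fun γ (_ : γ ∈ densityPolicies μ) => objective μ lam h γ) _
    (gibbsMeasure_mem_densityPolicies hint)

/-- The Gibbs measure is the unique maximizer of the entropy-regularized objective. -/
theorem isUniqueMaximizer_gibbsMeasure [SigmaFinite μ] [NeZero μ] (hlam : 0 < lam)
    (hh : Measurable h) (hint : Integrable (fun a => Real.exp (h a / lam)) μ) :
    IsUniqueMaximizer (densityPolicies μ) (objective μ lam h) (gibbsMeasure μ lam h) := by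
  refine ⟨gibbsMeasure_mem_densityPolicies hint, ?_, fun γ' hγ' heq => ?_⟩
  · rw [iSup_objective hlam hh hint, objective_gibbsMeasure hlam hint]
  · rw [iSup_objective hlam hh hint] at heq
    exact eq_gibbsMeasure_of_objective_eq hlam hh hint hγ' heq.symm

end General

/-! ### Lebesgue measure on U and bounded coefficients -/

section Lebesgue

variable {d m : ℕ} {U : Set (EuclideanSpace ℝ (Fin d))}

theorem lebesgueOn_univ (hU : MeasurableSet U) : lebesgueOn U Set.univ = volume U := by
  rw [lebesgueOn, comap_subtype_coe_apply hU, Set.image_univ, Subtype.range_coe]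

theorem sigmaFinite_lebesgueOn (hU : MeasurableSet U) : SigmaFinite (lebesgueOn U) := by
  refine SigmaFinite.of_map _ (f := Subtype.val) measurable_subtype_coe.aemeasurable ?_
  rw [lebesgueOn, map_comap_subtype_coe hU]
  infer_instance

/-- This is where positive volume enters: it makes the partition function strictly positive. -/
theorem neZero_lebesgueOn (hU : MeasurableSet U) (hU0 : 0 < volume U) :
    NeZero (lebesgueOn U) := by
  refine ⟨fun h0 => hU0.ne' ?_⟩
  rw [← lebesgueOn_univ hU, h0]
  simp

theorem preHamiltonian_le {A : Type*}
    {b : ℝ → EuclideanSpace ℝ (Fin m) → A → EuclideanSpace ℝ (Fin m)}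
    {R : ℝ → EuclideanSpace ℝ (Fin m) → A → ℝ} {t : ℝ} {y : EuclideanSpace ℝ (Fin m)}
    {C : ℝ} {a : A} (hb : ‖b t y a‖ ≤ C) (hR : |R t y a| ≤ C)
    (p : EuclideanSpace ℝ (Fin m)) : preHamiltonian b R t y a p ≤ ‖p‖ * C + C :=
  add_le_add ((real_inner_le_norm _ _).trans (by gcongr)) ((le_abs_self _).trans hR)

variable {A : Type*} [MeasurableSpace A]
  {b : ℝ → EuclideanSpace ℝ (Fin m) → A → EuclideanSpace ℝ (Fin m)}
  {R : ℝ → EuclideanSpace ℝ (Fin m) → A → ℝ} {t : ℝ} {y : EuclideanSpace ℝ (Fin m)}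

theorem measurable_preHamiltonian (hb : Measurable (b t y)) (hR : Measurable (R t y))
    (p : EuclideanSpace ℝ (Fin m)) : Measurable fun a => preHamiltonian b R t y a p :=
  (measurable_const.inner hb).add hR

theorem integrable_exp_preHamiltonian {μ : Measure A} [IsFiniteMeasure μ] {lam : ℝ}
    (hlam : 0 < lam) (hb : Measurable (b t y)) (hR : Measurable (R t y)) {C : ℝ}
    (hC : ∀ a, ‖b t y a‖ ≤ C ∧ |R t y a| ≤ C) (p : EuclideanSpace ℝ (Fin m)) :
    Integrable (fun a => Real.exp (preHamiltonian b R t y a p / lam)) μ := by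
  refine Integrable.of_bound (C := Real.exp ((‖p‖ * C + C) / lam))
    (((measurable_preHamiltonian hb hR p).div_const lam).exp.aestronglyMeasurable)
    (ae_of_all _ fun a => ?_)
  rw [Real.norm_of_nonneg (Real.exp_pos _).le]
  have := preHamiltonian_le (hC a).1 (hC a).2 p
  gcongr

end Lebesgue

end GibbsPolicy

open GibbsPolicy in
theorem mainTheorem7 {d m : ℕ} (U : Set (EuclideanSpace ℝ (Fin d))) (hU : MeasurableSet U)
    (hU0 : 0 < volume U) (lam : ℝ) (hlam : 0 < lam) :
    -- the optimization problem with entropy, for a general measurable function on `U`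
    (∀ h : U → ℝ, Measurable h → Integrable (fun a => Real.exp (h a / lam)) (lebesgueOn U) →
      -- `L(γ, h)` is well defined in `[-∞, ∞)`
      (∀ γ ∈ densityPolicies (lebesgueOn U),
        ∫⁻ a, ENNReal.ofReal (objectiveIntegrand (lebesgueOn U) lam h γ a) ∂(lebesgueOn U) < ⊤) ∧
      density (lebesgueOn U) (gibbsMeasure (lebesgueOn U) lam h) =ᵐ[lebesgueOn U]
        (fun a => Real.exp (h a / lam) / ∫ a', Real.exp (h a' / lam) ∂(lebesgueOn U)) ∧
      IsUniqueMaximizer (densityPolicies (lebesgueOn U)) (objective (lebesgueOn U) lam h)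
        (gibbsMeasure (lebesgueOn U) lam h) ∧
      (⨆ γ ∈ densityPolicies (lebesgueOn U), objective (lebesgueOn U) lam h γ) =
        ((lam * Real.log (∫ a, Real.exp (h a / lam) ∂(lebesgueOn U)) : ℝ) : EReal)) ∧
    -- the Hamiltonian and the feedback policy
    (∀ (T : ℝ) (b : ℝ → EuclideanSpace ℝ (Fin m) → U → EuclideanSpace ℝ (Fin m))
      (R : ℝ → EuclideanSpace ℝ (Fin m) → U → ℝ) (v : ℝ → EuclideanSpace ℝ (Fin m) → ℝ),
      ∀ t ∈ Set.Icc 0 T, ∀ y : EuclideanSpace ℝ (Fin m),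
        Measurable (b t y) → Measurable (R t y) → DifferentiableAt ℝ (v t) y →
        -- finiteness of the partition function is automatic for bounded coefficients when `U` has
        -- finite volume
        ((volume U < ⊤ ∧ ∃ C : ℝ, ∀ a : U, ‖b t y a‖ ≤ C ∧ |R t y a| ≤ C) →
          Integrable (fun a : U =>
            Real.exp (preHamiltonian b R t y a (gradient (v t) y) / lam)) (lebesgueOn U)) ∧
        (Integrable (fun a : U =>
            Real.exp (preHamiltonian b R t y a (gradient (v t) y) / lam)) (lebesgueOn U) →
          density (lebesgueOn U) (feedbackPolicy (lebesgueOn U) lam b R v t y) =ᵐ[lebesgueOn U]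
            (fun a => Real.exp (preHamiltonian b R t y a (gradient (v t) y) / lam) /
              ∫ a', Real.exp (preHamiltonian b R t y a' (gradient (v t) y) / lam)
                ∂(lebesgueOn U)) ∧
          IsUniqueMaximizer (densityPolicies (lebesgueOn U))
            (fun γ => hamiltonian (lebesgueOn U) lam b R t y γ (gradient (v t) y))
            (feedbackPolicy (lebesgueOn U) lam b R v t y) ∧
          (⨆ γ ∈ densityPolicies (lebesgueOn U),
              hamiltonian (lebesgueOn U) lam b R t y γ (gradient (v t) y)) =
            ((lam * Real.log
              (∫ a, Real.exp (preHamiltonian b R t y a (gradient (v t) y) / lam)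
                ∂(lebesgueOn U)) : ℝ) : EReal))) := by
  have := sigmaFinite_lebesgueOn hU
  have := neZero_lebesgueOn hU hU0
  refine ⟨fun h hh hint => ⟨fun γ hγ => lintegral_objectiveIntegrand_lt_top hlam hint hγ,
    density_gibbsMeasure hint, isUniqueMaximizer_gibbsMeasure hlam hh hint,
    iSup_objective hlam hh hint⟩, fun T b R v t _ y hb hR _ => ⟨?_, fun hint => ?_⟩⟩
  · rintro ⟨hfin, C, hC⟩
    have : IsFiniteMeasure (lebesgueOn U) := ⟨by rwa [lebesgueOn_univ hU]⟩
    exact integrable_exp_preHamiltonian hlam hb hR hC _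
  · have hh := measurable_preHamiltonian hb hR (gradient (v t) y)
    -- `hamiltonian` and `feedbackPolicy` unfold to `objective` and `gibbsMeasure` for this h, so
    -- the general results apply definitionally.
    exact ⟨density_gibbsMeasure hint, isUniqueMaximizer_gibbsMeasure hlam hh hint,
      iSup_objective hlam hh hint⟩
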